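/- **Theorem (Resilient Undecidability).** *Flooding.* Let $G=(V,E)$ be a simple, finite, connected graph with a source $g_0\in V$. A delay function $d:\mathbb N\times V\times E\to\{0,1\}$ says whether in round $j$ the transmission from $v$ along an incident edge $e$ is blocked ($d(j,v,e)=1$) or allowed ($d(j,v,e)=0$). In Round-Delayed Amnesiac Flooding every node $u$ has in round $j$ a state $(M(j,u),s(j,u),\mathrm{dest}(j,u))$. Initially $g_0$ has state $(1,\emptyset,N(g_0))$ and all other nodes have state $(0,\emptyset,\emptyset)$. In round $j+1$, let $$s=\{v\in N(u): u\in \mathrm{dest}(j,v),\ d(j+1,v,\{v,u\})=0\},\qquad p=\{v\in\mathrm{dest}(j,u): d(j+1,u,\{u,v\})=1\}.$$ If $s\ne\emptyset$, the new state of $u$ is $(1,s,N(u)\setminus s)$; if $s=\emptyset\neq p$, it is $(1,\emptyset,p)$; otherwise it is $(0,\emptyset,\emptyset)$. Flooding terminates if $M(t,u)=0$ for all $u\in V$, for some round $t$. A delay function has the finite delay property if no pair $(v,e)$ with $v\in e$ is blocked in all rounds from some round on. *Adversaries.* Let $f:\mathbb N\to\mathbb N$. An adversary is a deterministic Turing machine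 which is run once in each round $n=0,1,2,\dots$ It has a work tape that persists between rounds, and a read-only clock tape that in round $n$ holds its budget $f(n)$ in unary. The state in which the computation of a round ends determines the delays of this round and the state in which the next round starts. The adversary is *$f$-bounded* on $G$ if the computation of every round ends, in round $n$ it makes $O(f(n))$ steps and uses $O(f(n))$ cells of its work tape (counting the cells that are non-blank at the start of the round and those visited in it), and its delay function is computable and has the finite delay property. The constants in $O(\cdot)$ may depend on the adversary. *Claim.* Let $f:\mathbb N\to\mathbb N$ be computable with $\lim_{n\to\infty}f(n)=\infty$. Then: 1. $f$-bounded adversaries can simulate $f(n)$ Turing machine steps in round $n$: for every Turing machine $M$ there is a computable map which sends each input $x$ of $M$ to an adversary that is $f$-bounded on the triangle, such that in every round $n$ this adversary blocks nothing if and only if $M$ halts on $x$ within $f(n)$ steps, and flooding on the triangle (from a fixed source) under this adversary terminates if and only if $M$ halts on $x$. 2. Termination of flooding is undecidable for $f$-bounded adversaries: there is no algorithm which, given a finite connected graph $G$, a source $g_0$ and the program of an adversary that is $f$-bounded on $G$, always stops and correctly answers whether flooding on $G$ from $g_0$ under this adversary terminates. In particular both hold for the inverse Ackermann function $f(n)=\min\{m: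 A(m,m)>n\}$, where $A$ is the two-argument Ackermann function. -/

import Mathlib

open Filter

namespace RDAF

/-! ## Round-delayed amnesiac flooding -/

/-- The state record `(M, s, dest)` of a node in some round. -/
structure NodeState (V : Type) where
  /-- does the node possess the message? -/
  msg : Bool
  /-- the neighbours which delivered the message to the node in this round -/
  src : Finset V
  /-- the neighbours to which the node intends to forward the message -/
  dest : Finset V

/-- A delay function: `d j v u = true` means that in round `j` the transmission from the node `v`
along the edge `{v, u}` is blocked. Only the values at adjacent `v`, `u` matter. -/
abbrev DelayFun (V : Type) := ℕ → V → V → Bool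

section Flooding

variable {V : Type} [Fintype V] [DecidableEq V]

/-- The states of all nodes at the end of each round, for flooding on `G` from the source `g₀`
under the delay function `d`. Round `0` is the initial configuration. -/
def flood (G : SimpleGraph V) [DecidableRel G.Adj] (g₀ : V) (d : DelayFun V) :
    ℕ → V → NodeState V
  | 0, u => if u = g₀ then ⟨true, ∅, G.neighborFinset g₀⟩ else ⟨false, ∅, ∅⟩
  | j + 1, u =>
    -- the neighbours that deliver to `u` in round `j + 1`
    let received := Finset.univ.filter fun v =>
      G.Adj v u ∧ u ∈ (flood G g₀ d j v).dest ∧ d (j + 1) v u = false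
    -- the transmissions of `u` that are delayed in round `j + 1`
    let pending := (flood G g₀ d j u).dest.filter fun v => d (j + 1) u v = true
    if received.Nonempty then ⟨true, received, G.neighborFinset u \ received⟩
    else ⟨decide pending.Nonempty, ∅, pending⟩

/-- Flooding terminates: in some round no node possesses the message. -/
def Terminates (G : SimpleGraph V) [DecidableRel G.Adj] (g₀ : V) (d : DelayFun V) : Prop :=
  ∃ t, ∀ v, (flood G g₀ d t v).msg = false

/-- The finite delay property: no node-edge pair is blocked in all rounds from some round on. -/
def FiniteDelay (G : SimpleGraph V) (d : DelayFun V) : Prop :=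
  ∀ v u, G.Adj v u → ∀ t, ∃ j, t ≤ j ∧ d j v u = false

end Flooding

/-! ## Adversaries as machines

An adversary is a deterministic Turing machine that is run once in every round. It has a
bi-infinite work tape, which persists between the rounds, and a read-only clock tape, which in
round `n` carries the budget `f n` in unary: its cells `0, …, f n - 1` are marked and all its other
cells are blank. States and tape symbols are natural numbers, of which the finite list of rules
mentions only finitely many; the symbol `0` is the blank and the initial state is `0`. -/

/-- A head move: `0` is one cell to the left, `1` is no move, `2` is one cell to the right. -/
abbrev HeadMove := Fin 3

/-- The displacement that belongs to a head move. -/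
def HeadMove.shift (m : HeadMove) : ℤ := (m.val : ℤ) - 1

/-- A rule `((q, a, b), (q', a', m, m'))`: in state `q`, with `a` under the work head and with `b`
telling whether the clock head is on a marked cell, change to state `q'`, write `a'` on the work
tape, and move the work head by `m` and the clock head by `m'`. -/
abbrev Rule := (ℕ × ℕ × Bool) × (ℕ × ℕ × HeadMove × HeadMove)

/-- An entry `(q, q', L)`: if the computation of a round ends in state `q`, then the next round
starts in state `q'`, and `L` lists the pairs `(v, u)` for which the transmission
from `v` along `{v, u}` is blocked in this round. -/
abbrev Ending := ℕ × ℕ × List (ℕ × ℕ)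

/-- An adversary: the first matching rule or ending applies. The computation of a round ends as
soon as no rule applies. -/
structure Adversary where
  rules : List Rule
  endings : List Ending

/-- An adversary is coded as the pair of its two lists. -/
def Adversary.equiv : Adversary ≃ List Rule × List Ending where
  toFun A := (A.rules, A.endings)
  invFun p := ⟨p.1, p.2⟩
  left_inv _ := rfl
  right_inv _ := rfl

instance : Primcodable Adversary := Primcodable.ofEquiv _ Adversary.equiv

/-- A configuration of an adversary. -/
structure Config where
  state : ℕ
  /-- the content of the work tape -/
  tape : ℤ → ℕ
  /-- the position of the work head -/
  pos : ℤ
  /-- the position of the clock head -/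
  clock : ℤ

namespace Adversary

/-- One step of the adversary with budget `b`; `none` if no rule applies. -/
def step (A : Adversary) (b : ℕ) (c : Config) : Option Config :=
  (A.rules.find? fun r =>
    decide (r.1 = (c.state, c.tape c.pos, decide (0 ≤ c.clock ∧ c.clock < (b : ℤ))))).map
  fun r =>
    { state := r.2.1
      tape := Function.update c.tape c.pos r.2.2.1
      pos := c.pos + r.2.2.2.1.shift
      clock := c.clock + r.2.2.2.2.shift }

/-- The configuration reached from `c` after exactly `i` steps with budget `b`, if any. -/
def stepsFrom (A : Adversary) (b : ℕ) (c : Config) : ℕ → Option Config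
  | 0 => some c
  | i + 1 => (A.stepsFrom b c i).bind (A.step b)

/-- What happens if a round ends in state `q`: the state in which the next round starts, and the
blocked pairs. Without a matching ending the state is kept and nothing is blocked. -/
def ending (A : Adversary) (q : ℕ) : ℕ × List (ℕ × ℕ) :=
  ((A.endings.find? fun e => decide (e.1 = q)).map Prod.snd).getD (q, [])

/-- The start of the next round after a round that ended in `c`: the work tape and the work head
stay as they are, and the clock head returns to cell `0`. -/
def nextRound (A : Adversary) (c : Config) : Config :=
  { c with state := (A.ending c.state).1, clock := 0 }

/-- The run of the adversary `A` through all rounds, with budget `f n` in round `n`. It exists if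
and only if the computation of every round ends, and then it is unique. -/
structure Run (A : Adversary) (f : ℕ → ℕ) where
  /-- the configuration at the start of each round -/
  start : ℕ → Config
  /-- the configuration at the end of each round -/
  finish : ℕ → Config
  /-- the number of steps made in each round -/
  time : ℕ → ℕ
  start_zero : start 0 = ⟨0, fun _ => 0, 0, 0⟩
  reaches : ∀ n, A.stepsFrom (f n) (start n) (time n) = some (finish n)
  halts : ∀ n, A.step (f n) (finish n) = none
  start_succ : ∀ n, start (n + 1) = A.nextRound (finish n)

namespace Run

variable {A : Adversary} {f : ℕ → ℕ} (R : A.Run f)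

/-- The cells of the work tape in use in round `n`: those that are not blank when the
round starts, and those that the work head visits during the round. -/
def cells (n : ℕ) : Set ℤ :=
  {z | (R.start n).tape z ≠ 0 ∨
    ∃ i ≤ R.time n, ∃ c, A.stepsFrom (f n) (R.start n) i = some c ∧ c.pos = z}

/-- The adversary uses `O(f n)` time and `O(f n)` space in round `n`. -/
def WithinBudget : Prop :=
  ∃ C : ℕ, ∀ᶠ n in atTop,
    R.time n ≤ C * f n ∧ (R.cells n).encard ≤ ((C * f n : ℕ) : ℕ∞)

/-- The delay function on the vertex set `{0, …, N - 1}` that the adversary produces. -/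
def delay (N : ℕ) : DelayFun (Fin N) := fun n v u =>
  decide ((v.val, u.val) ∈ (A.ending (R.finish n).state).2)

/-- The run makes the adversary an admissible one on the network `G`: it uses `O(f n)` time and
space in round `n`, and its delay function is computable and has the finite delay property. -/
structure Admissible {N : ℕ} (G : SimpleGraph (Fin N)) : Prop where
  withinBudget : R.WithinBudget
  computable : Computable fun p : ℕ × Fin N × Fin N => R.delay N p.1 p.2.1 p.2.2
  finiteDelay : FiniteDelay G (R.delay N)

end Run

end Adversary

/-! ## The termination problem -/

/-- An input of the termination problem: a graph with vertices `0, …, order - 1`, given by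
a list of edges, a source, and an adversary. -/
structure Input where
  order : ℕ
  edges : List (ℕ × ℕ)
  source : ℕ
  adversary : Adversary

/-- An input is coded as the tuple of its components. -/
def Input.equiv : Input ≃ ℕ × List (ℕ × ℕ) × ℕ × Adversary where
  toFun I := (I.order, I.edges, I.source, I.adversary)
  invFun p := ⟨p.1, p.2.1, p.2.2.1, p.2.2.2⟩
  left_inv _ := rfl
  right_inv _ := rfl

instance : Primcodable Input := Primcodable.ofEquiv _ Input.equiv

/-- The simple graph of an input. -/
def Input.graph (I : Input) : SimpleGraph (Fin I.order) :=
  SimpleGraph.fromRel fun u v => (u.val, v.val) ∈ I.edges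

instance (I : Input) : DecidableRel I.graph.Adj := fun u v =>
  decidable_of_iff (u ≠ v ∧ ((u.val, v.val) ∈ I.edges ∨ (v.val, u.val) ∈ I.edges))
    (SimpleGraph.fromRel_adj (fun u v : Fin I.order => (u.val, v.val) ∈ I.edges) u v).symm

/-- The procedure `D` decides termination of flooding for adversaries with `O(f n)` time and space
in round `n`: on every input with a connected graph, a source in the graph and an
admissible adversary, it stops with the right answer. Nothing is asked of it on other inputs. -/
def Decides (f : ℕ → ℕ) (D : Input →. Bool) : Prop :=
  ∀ (I : Input) (g₀ : Fin I.order) (R : I.adversary.Run f),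
    g₀.val = I.source → I.graph.Connected → R.Admissible I.graph →
      ∃ b ∈ D I, (b = true ↔ Terminates I.graph g₀ (R.delay I.order))

/-- Termination of flooding is undecidable for adversaries with `O(f n)` time and space
in round `n`. -/
def TerminationUndecidable (f : ℕ → ℕ) : Prop :=
  ¬ ∃ D : Input →. Bool, Partrec D ∧ Decides f D

/-! ## Simulation of Turing machines -/

section TuringMachine

variable {Γ Λ : Type} [Inhabited Γ] [Inhabited Λ]

/-- The configuration of the Turing machine `M` on input `x` after exactly `i` steps, if any. -/
def tmSteps (M : Turing.TM0.Machine Γ Λ) (x : List Γ) : ℕ → Option (Turing.TM0.Cfg Γ Λ)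
  | 0 => some (Turing.TM0.init x)
  | i + 1 => (tmSteps M x i).bind (Turing.TM0.step M)

/-- The Turing machine `M` halts on input `x` within `k` steps. -/
def HaltsWithin (M : Turing.TM0.Machine Γ Λ) (x : List Γ) (k : ℕ) : Prop :=
  ∃ i ≤ k, ∃ c, tmSteps M x i = some c ∧ Turing.TM0.step M c = none

end TuringMachine

/-- Adversaries with `O(f n)` time and space in round `n` can simulate `f n` steps of any Turing
machine in round `n`. For every machine `M` there is a computable map that turns an input `x` of
`M` into an admissible adversary on the triangle. In every round `n` this adversary delays nothing
exactly if `M` halts on `x` within `f n` steps, and flooding terminates under it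
exactly if `M` halts on `x`. -/
def CanSimulate (f : ℕ → ℕ) : Prop :=
  ∀ (k : ℕ) (Λ : Type) [Inhabited Λ] [Finite Λ] (M : Turing.TM0.Machine (Fin (k + 1)) Λ),
    ∃ sim : List (Fin (k + 1)) → Adversary, Computable sim ∧
      ∀ x, ∃ R : (sim x).Run f,
        R.Admissible (⊤ : SimpleGraph (Fin 3)) ∧
        (∀ n, (∀ v u : Fin 3, v ≠ u → R.delay 3 n v u = false) ↔ HaltsWithin M x (f n)) ∧
        (Terminates (⊤ : SimpleGraph (Fin 3)) 0 (R.delay 3) ↔ ∃ t, HaltsWithin M x t)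

/-- The inverse Ackermann function `α(n) = min {m | A(m, m) > n}`. -/
noncomputable def inverseAckermann (n : ℕ) : ℕ := sInf {m | n < ack m m}

end RDAF

namespace RDAF

/-! ## The inverse Ackermann function -/

/-! On the triangle, one well-chosen delay in every second round keeps the message alive. The
forwarding intentions then run through a cycle of four configurations (`cycleDest`). After an odd
round two nodes are about to send to each other; after an even round both are about to send to the
third node. If both of the latter transmissions arrive, the third node has nobody left to forward to
and flooding dies; if one of them is delayed, the cycle goes on. Hence flooding terminates if almost
all rounds are quiet, and never terminates if none is (`terminates_triangle_of_eventually_quiet`,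
`not_terminates_triangle_of_not_quiet`).

The adversary restarts the machine in every round: it writes the input on the blank work tape, runs
the machine while the clock head advances by one cell per step, stores in its state whether the
machine halted, and erases the tape. Written and visited cells are never left blank before erasing,
so they form an interval whose ends can be found. A round costs time linear in the input length plus
`f n`; as the input is fixed and `f` tends to infinity, this is `O(f n)`. Round `n` is quiet exactly
if the machine halts within `f n` steps (`Coding.exists_run`). Since `f` tends to infinity, a
halting machine makes almost all rounds quiet, even when `f` is not monotone.

Undecidability follows by applying this to one fixed machine whose halting problem is undecidable on
a computable family of inputs (`exists_undecidable_machine`). The inverse Ackermann function is an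
instance because it is unbounded, monotone growth of `ack` giving the limit, and computable by
search. -/

theorem lt_ack_self_inverseAckermann (n : ℕ) : n < ack (inverseAckermann n) (inverseAckermann n) :=
  Nat.sInf_mem (s := {m | n < ack m m}) ⟨n, lt_ack_left n n⟩

theorem inverseAckermann_le {n m : ℕ} (h : n < ack m m) : inverseAckermann n ≤ m :=
  Nat.sInf_le h

theorem tendsto_inverseAckermann : Tendsto inverseAckermann atTop atTop := by
  refine tendsto_atTop.2 fun b => eventually_atTop.2 ⟨ack b b, fun n hn => ?_⟩
  by_contra h
  exact absurd ((lt_ack_self_inverseAckermann n).trans_le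
    (ack_le_ack (not_le.1 h).le (not_le.1 h).le)) (not_lt.2 hn)

theorem computable_inverseAckermann : Computable inverseAckermann := by
  have h : Computable₂ fun n m : ℕ => decide (n < ack m m) := by
    refine (Primrec.nat_lt.decide.to_comp).comp Computable.fst
      (computable₂_ack.comp Computable.snd Computable.snd)
  refine (Partrec.rfind h.partrec₂).of_eq fun n => ?_
  refine Part.eq_some_iff.2 (Nat.mem_rfind.2 ⟨?_, fun {m} hm => ?_⟩)
  · simpa using lt_ack_self_inverseAckermann n
  · simpa using fun h' => (not_lt.2 (inverseAckermann_le h')) hm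

/-! ## Flooding on the triangle -/

section Flooding

variable {V : Type} [Fintype V] [DecidableEq V] (G : SimpleGraph V) [DecidableRel G.Adj]

/-- The neighbours that deliver to `u` in a round with blocked transmissions `b`, when the
forwarding intentions are `D`. -/
def received (b : V → V → Bool) (D : V → Finset V) (u : V) : Finset V :=
  Finset.univ.filter fun v => G.Adj v u ∧ u ∈ D v ∧ b v u = false

/-- The forwarding intentions after a round. -/
def nextDest (b : V → V → Bool) (D : V → Finset V) (u : V) : Finset V :=
  if (received G b D u).Nonempty then G.neighborFinset u \ received G b D u
  else (D u).filter fun v => b u v = true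

variable (g₀ : V) (d : DelayFun V)

/-- The forwarding intentions evolve on their own: neither the message bits nor the senders of the
previous round influence them. -/
theorem flood_succ_dest (j : ℕ) :
    (fun u => (flood G g₀ d (j + 1) u).dest) =
      nextDest G (d (j + 1)) fun u => (flood G g₀ d j u).dest := by
  funext u
  simp only [flood, nextDest, received]
  split_ifs <;> rfl

theorem flood_msg_of_dest_nonempty (j : ℕ) (u : V) (h : (flood G g₀ d j u).dest.Nonempty) :
    (flood G g₀ d j u).msg = true := by
  cases j with
  | zero =>
    simp only [flood] at h ⊢
    split_ifs at h ⊢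
    · rfl
    · simp at h
  | succ j =>
    simp only [flood] at h ⊢
    split_ifs at h ⊢
    · rfl
    · simpa using h

theorem flood_msg_succ_of_dest_empty (j : ℕ) (h : ∀ u, (flood G g₀ d j u).dest = ∅) (u : V) :
    (flood G g₀ d (j + 1) u).msg = false := by
  simp [flood, h]

end Flooding

/-- The transmission on the triangle that a non-quiet round blocks, by the round modulo `4`. -/
def blockedPair (ph : ℕ) : ℕ × ℕ :=
  if ph % 2 = 0 then (0, 2) else if ph = 1 then (1, 2) else (1, 0)

/-- The delay function on the triangle which blocks nothing in the rounds with `quiet`, and one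
transmission in all other rounds. -/
def triangleDelay (quiet : ℕ → Bool) : DelayFun (Fin 3) := fun n v u =>
  !quiet n && decide ((v.val, u.val) = blockedPair (n % 4))

/-- The forwarding intentions after round `n ≥ 1`, by `n` modulo `4`, as long as flooding goes on. -/
def cycleDest : ℕ → Fin 3 → Finset (Fin 3)
  | 0 => ![{2}, {2}, ∅]
  | 1 => ![∅, {2}, {1}]
  | 2 => ![∅, {0}, {0}]
  | _ => ![{1}, {0}, ∅]

/-- Only the blocks in odd rounds matter. In even rounds the blocked transmission `(0, 2)` is not
intended by anybody; it is there only so that a non-quiet round blocks something. -/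
theorem nextDest_cycleDest_of_not_quiet : ∀ ph < 4, nextDest (⊤ : SimpleGraph (Fin 3))
    (fun v u => decide ((v.val, u.val) = blockedPair ((ph + 1) % 4))) (cycleDest ph) =
      cycleDest ((ph + 1) % 4) := by
  decide

theorem nextDest_cycleDest_of_odd : ∀ ph < 4, ph % 2 = 1 → nextDest (⊤ : SimpleGraph (Fin 3))
    (fun _ _ => false) (cycleDest ph) = cycleDest ((ph + 1) % 4) := by
  decide

theorem nextDest_cycleDest_of_even : ∀ ph < 4, ph % 2 = 0 → ∀ u, nextDest (⊤ : SimpleGraph (Fin 3))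
    (fun _ _ => false) (cycleDest ph) u = ∅ := by
  decide

theorem exists_cycleDest_nonempty : ∀ ph < 4, ∃ u, (cycleDest ph u).Nonempty := by
  decide

/-- In round `1` only the source sends, so the blocked pair `(1, 2)` has no effect and flooding
enters the cycle in either case. -/
theorem nextDest_start (q : Bool) : nextDest (⊤ : SimpleGraph (Fin 3))
    (fun v u => !q && decide ((v.val, u.val) = blockedPair 1))
      ![{1, 2}, ∅, ∅] = cycleDest 1 := by
  revert q; decide

theorem triangleDelay_of_not_quiet {quiet : ℕ → Bool} {n : ℕ} (h : quiet n = false) :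
    triangleDelay quiet n = fun v u => decide ((v.val, u.val) = blockedPair (n % 4)) := by
  funext v u; simp [triangleDelay, h]

theorem triangleDelay_of_quiet {quiet : ℕ → Bool} {n : ℕ} (h : quiet n = true) :
    triangleDelay quiet n = fun _ _ => false := by
  funext v u; simp [triangleDelay, h]

theorem flood_triangle_zero_dest (d : DelayFun (Fin 3)) :
    (fun u => (flood (⊤ : SimpleGraph (Fin 3)) 0 d 0 u).dest) = ![{1, 2}, ∅, ∅] := by
  funext u
  fin_cases u <;> simp [flood]
  decide

theorem flood_triangle_one_dest (quiet : ℕ → Bool) :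
    (fun u => (flood (⊤ : SimpleGraph (Fin 3)) 0 (triangleDelay quiet) 1 u).dest) =
      cycleDest 1 := by
  rw [flood_succ_dest, flood_triangle_zero_dest]
  exact nextDest_start (quiet 1)

theorem flood_triangle_or_terminates (quiet : ℕ → Bool) (j : ℕ) :
    (fun u => (flood (⊤ : SimpleGraph (Fin 3)) 0 (triangleDelay quiet) (j + 1) u).dest) =
      cycleDest ((j + 1) % 4) ∨
    ((∃ n, quiet n = true) ∧
      Terminates (⊤ : SimpleGraph (Fin 3)) 0 (triangleDelay quiet)) := by
  induction j with
  | zero => exact .inl (flood_triangle_one_dest quiet)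
  | succ j ih =>
    rcases ih with ih | ih
    · have hlt : (j + 1) % 4 < 4 := Nat.mod_lt _ (by norm_num)
      have hs := flood_succ_dest (⊤ : SimpleGraph (Fin 3)) 0 (triangleDelay quiet) (j + 1)
      rw [ih] at hs
      have hmod : ((j + 1) % 4 + 1) % 4 = (j + 1 + 1) % 4 := by omega
      cases hq : quiet (j + 1 + 1) with
      | false =>
        rw [triangleDelay_of_not_quiet hq, ← hmod, nextDest_cycleDest_of_not_quiet _ hlt,
          hmod] at hs
        exact .inl hs
      | true =>
        rw [triangleDelay_of_quiet hq] at hs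
        rcases Nat.mod_two_eq_zero_or_one ((j + 1) % 4) with h | h
        -- One more round is needed: the node that received last still holds the message, with
        -- nobody to forward it to.
        · refine .inr ⟨⟨_, hq⟩, j + 1 + 1 + 1, flood_msg_succ_of_dest_empty _ _ _ _ fun u => ?_⟩
          exact (congrFun hs u).trans (nextDest_cycleDest_of_even _ hlt h u)
        · rw [nextDest_cycleDest_of_odd _ hlt h, hmod] at hs
          exact .inl hs
    · exact .inr ih

theorem terminates_triangle_of_eventually_quiet {quiet : ℕ → Bool}
    (h : ∀ᶠ n in atTop, quiet n = true) :
    Terminates (⊤ : SimpleGraph (Fin 3)) 0 (triangleDelay quiet) := by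
  obtain ⟨N, hN⟩ := eventually_atTop.1 h
  -- Round `4 * N + 2` is even and not before `N`, so the next round is quiet and delivers both
  -- transmissions to the same node.
  rcases flood_triangle_or_terminates quiet (4 * N + 1) with hc | hc
  · have hs := flood_succ_dest (⊤ : SimpleGraph (Fin 3)) 0 (triangleDelay quiet) (4 * N + 1 + 1)
    rw [hc, triangleDelay_of_quiet (hN _ (by omega))] at hs
    refine ⟨4 * N + 1 + 1 + 1 + 1, flood_msg_succ_of_dest_empty _ _ _ _ fun u => ?_⟩
    exact (congrFun hs u).trans
      (nextDest_cycleDest_of_even _ (Nat.mod_lt _ (by norm_num)) (by omega) u)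
  · exact hc.2

theorem not_terminates_triangle_of_not_quiet {quiet : ℕ → Bool} (h : ∀ n, quiet n = false) :
    ¬ Terminates (⊤ : SimpleGraph (Fin 3)) 0 (triangleDelay quiet) := by
  rintro ⟨t, ht⟩
  suffices ∃ u, (flood (⊤ : SimpleGraph (Fin 3)) 0 (triangleDelay quiet) t u).dest.Nonempty by
    obtain ⟨u, hu⟩ := this
    simpa [ht u] using flood_msg_of_dest_nonempty _ _ _ _ _ hu
  cases t with
  | zero => exact ⟨0, by rw [congrFun (flood_triangle_zero_dest _) 0]; simp⟩
  | succ j =>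
    rcases flood_triangle_or_terminates quiet j with hc | ⟨⟨n, hn⟩, -⟩
    · obtain ⟨u, hu⟩ := exists_cycleDest_nonempty ((j + 1) % 4) (Nat.mod_lt _ (by norm_num))
      exact ⟨u, by rw [congrFun hc u]; exact hu⟩
    · simp [h n] at hn

/-- The pair blocked in phase `0` is free in phase `1`, and every other pair is free in phase `0`.
-/
theorem finiteDelay_triangleDelay (quiet : ℕ → Bool) :
    FiniteDelay (⊤ : SimpleGraph (Fin 3)) (triangleDelay quiet) := by
  intro v u _ t
  by_cases h : (v.val, u.val) = blockedPair 0
  · refine ⟨4 * t + 1, by omega, ?_⟩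
    have : (4 * t + 1) % 4 = 1 := by omega
    simp [triangleDelay, h, this, blockedPair]
  · refine ⟨4 * t, by omega, ?_⟩
    have : (4 * t) % 4 = 0 := by omega
    simp [triangleDelay, h, this]

theorem exists_eq_blockedPair : ∀ ph < 4,
    ¬ ∀ v u : Fin 3, v ≠ u → (v.val, u.val) ≠ blockedPair ph := by
  decide

theorem triangleDelay_eq_false_iff (quiet : ℕ → Bool) (n : ℕ) :
    (∀ v u : Fin 3, v ≠ u → triangleDelay quiet n v u = false) ↔ quiet n = true := by
  constructor
  · intro h
    by_contra hq
    rw [Bool.not_eq_true] at hq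
    rw [triangleDelay_of_not_quiet hq] at h
    have : n % 4 < 4 := Nat.mod_lt _ (by norm_num)
    exact exists_eq_blockedPair _ this fun v u hvu => by simpa using h v u hvu
  · intro h v u _
    simp [triangleDelay, h]

/-! ## The simulating adversary -/

/-- The states of the simulating adversary, without the phase of the round: it writes the input from
right to left, runs the machine, and erases the tape by moving to the right end of its
non-blank part and then erasing to the left. The flag says whether the machine has halted. -/
inductive SimState (Λ : Type)
  | write (j : ℕ)
  | run (q : Λ)
  | right (halted : Bool)
  | left (halted : Bool)

/-- Codes of the symbols and labels of a Turing machine by natural numbers. Besides `0`, which is a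
cell not yet visited, `code default` also represents a blank cell. -/
structure Coding {Γ Λ : Type} [Inhabited Γ] [Inhabited Λ] (M : Turing.TM0.Machine Γ Λ) where
  code : Γ → ℕ
  decode : ℕ → Γ
  bound : ℕ
  support : Finset Λ
  label : Λ → ℕ
  decode_code : ∀ a, decode (code a) = a
  decode_zero : decode 0 = default
  code_ne_zero : ∀ a, code a ≠ 0
  code_lt : ∀ a, code a < bound
  supports : Turing.TM0.Supports M (support : Set Λ)
  label_injOn : Set.InjOn label (support : Set Λ)

namespace Coding

open Turing

variable {Γ Λ : Type} [Inhabited Γ] [Inhabited Λ] {M : Turing.TM0.Machine Γ Λ} (E : Coding M)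

theorem bound_pos : 0 < E.bound := (Nat.zero_le _).trans_lt (E.code_lt default)

/-- The number of a state in the phase `ph`. -/
def enc (ph : ℕ) : SimState Λ → ℕ
  | .write j => Nat.pair 0 (Nat.pair ph j)
  | .run q => Nat.pair 1 (Nat.pair ph (E.label q))
  | .right h => Nat.pair 2 (Nat.pair ph h.toNat)
  | .left h => Nat.pair 3 (Nat.pair ph h.toNat)

/-- The states that occur: the labels come from the support of the machine. -/
def Occurs : SimState Λ → Prop
  | .run q => q ∈ E.support
  | _ => True

/-- The labels are numbered injectively only on the finite support, which is why both states have to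
occur. -/
theorem enc_injOn {ph ph' : ℕ} {s s' : SimState Λ} (hs : E.Occurs s) (hs' : E.Occurs s')
    (h : E.enc ph s = E.enc ph' s') : ph = ph' ∧ s = s' := by
  have hinj : ∀ a b : Bool, a.toNat = b.toNat → a = b := by decide
  cases s <;> cases s' <;> simp [enc, Nat.pair_eq_pair] at h
  · exact ⟨h.1, by rw [h.2]⟩
  · exact ⟨h.1, by rw [E.label_injOn hs hs' h.2]⟩
  · exact ⟨h.1, by rw [hinj _ _ h.2]⟩
  · exact ⟨h.1, by rw [hinj _ _ h.2]⟩

/-- What the machine does to the tape: the symbol written and the move of the head. -/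
def action (a : ℕ) : TM0.Stmt Γ → ℕ × HeadMove
  | .move .left => (E.code (E.decode a), 0)
  | .move .right => (E.code (E.decode a), 2)
  | .write c => (E.code c, 1)

/-- The transition function for the reversed input `w`, given by codes. -/
def trans (w : List ℕ) : SimState Λ → ℕ → Bool → Option (SimState Λ × ℕ × HeadMove × HeadMove)
  | .write j, a, _ =>
    if a = 0 ∧ j ≤ w.length then
      some (if j < w.length then (.write (j + 1), w.getD j 0, 0, 1) else (.run default, 0, 2, 1))
    else none
  | .run q, a, b =>
    match M q (E.decode a) with
    | none => some (.right true, E.code (E.decode a), 1, 1)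
    | some (q', s) =>
      if b then some (.run q', (E.action a s).1, (E.action a s).2, 2)
      else some (.right false, E.code (E.decode a), 1, 1)
  | .right h, a, _ => some (if a = 0 then (.left h, 0, 0, 1) else (.right h, a, 2, 1))
  | .left h, a, _ => if a = 0 then none else some (.left h, 0, 0, 1)

/-- The rule for the transition from a state. -/
def rule (w : List ℕ) (ph : ℕ) (s : SimState Λ) (a : ℕ) (b : Bool) : Option Rule :=
  (E.trans w s a b).map fun r => ((E.enc ph s, a, b), (E.enc ph r.1, r.2))

/-- All phases, with all readings of the clock. -/
def phaseClocks : List (ℕ × Bool) :=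
  (List.range 4).flatMap fun ph => [(ph, false), (ph, true)]

theorem mem_phaseClocks {ph : ℕ} (hph : ph < 4) (b : Bool) : (ph, b) ∈ phaseClocks := by
  cases b <;> simp [phaseClocks, hph]

/-- The rules for writing the input. -/
def writeRules (w : List ℕ) : List Rule :=
  (List.range (w.length + 1)).flatMap fun j => phaseClocks.map fun p =>
    ((Nat.pair 0 (Nat.pair p.1 j), 0, p.2),
      if j < w.length then (Nat.pair 0 (Nat.pair p.1 (j + 1)), w.getD j 0, 0, 1)
      else (Nat.pair 1 (Nat.pair p.1 (E.label default)), 0, 2, 1))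

/-- The states after the input has been written. -/
noncomputable def coreStates : List (SimState Λ) :=
  E.support.toList.map .run ++ [.right false, .right true, .left false, .left true]

/-- The rules that do not depend on the input. -/
noncomputable def coreRules : List Rule :=
  phaseClocks.flatMap fun p => E.coreStates.flatMap fun s =>
    (List.range E.bound).filterMap fun a => E.rule [] p.1 s a p.2

theorem mem_writeRules_iff {w : List ℕ} {r : Rule} : r ∈ E.writeRules w ↔
    ∃ j ≤ w.length, ∃ p ∈ phaseClocks, E.rule w p.1 (.write j) 0 p.2 = some r := by
  simp only [writeRules, List.mem_flatMap, List.mem_range, List.mem_map, Nat.lt_succ_iff]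
  refine exists_congr fun j => and_congr_right fun hj => exists_congr fun p =>
    and_congr_right fun _ => ?_
  simp only [rule, trans, hj, and_self, if_true, Option.map_some, Option.some.injEq]
  split_ifs <;> rfl

theorem trans_nil (w : List ℕ) {s : SimState Λ} (hs : ∀ j, s ≠ .write j) (a : ℕ) (b : Bool) :
    E.trans [] s a b = E.trans w s a b := by
  cases s with
  | write j => exact absurd rfl (hs j)
  | _ => rfl

theorem mem_coreStates_iff {s : SimState Λ} :
    s ∈ E.coreStates ↔ E.Occurs s ∧ ∀ j, s ≠ .write j := by
  cases s with
  | right h => cases h <;> simp [coreStates, Occurs]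
  | left h => cases h <;> simp [coreStates, Occurs]
  | _ => simp [coreStates, Occurs]

theorem mem_coreRules_iff (w : List ℕ) {r : Rule} : r ∈ E.coreRules ↔
    ∃ p ∈ phaseClocks, ∃ s, (E.Occurs s ∧ ∀ j, s ≠ .write j) ∧ ∃ a < E.bound,
      E.rule w p.1 s a p.2 = some r := by
  simp only [coreRules, List.mem_flatMap, List.mem_filterMap, List.mem_range, mem_coreStates_iff]
  refine exists_congr fun p => and_congr_right fun _ => exists_congr fun s =>
    and_congr_right fun hs => ?_
  simp only [rule, E.trans_nil w hs.2]

/-- The endings: the state in which the erasing ends determines the blocked transmission, and the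
next round starts in the next phase. -/
def endings : List Ending :=
  (List.range 4).flatMap fun ph => [false, true].map fun h =>
    (Nat.pair 3 (Nat.pair ph h.toNat), Nat.pair 0 (Nat.pair ((ph + 1) % 4) 0),
      if h then [] else [blockedPair ph])

/-- The adversary that simulates the machine on the reversed input `w`. -/
noncomputable def adversary (w : List ℕ) : Adversary where
  rules := E.writeRules w ++ E.coreRules
  endings := endings

theorem primrec_writeRules : Primrec E.writeRules := by
  unfold writeRules
  refine Primrec.list_flatMap (Primrec.list_range.comp (Primrec.succ.comp Primrec.list_length)) ?_
  refine Primrec.list_map (Primrec.const _) ?_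
  have hw : Primrec fun x : (List ℕ × ℕ) × (ℕ × Bool) => x.1.1 := Primrec.fst.comp Primrec.fst
  have hj : Primrec fun x : (List ℕ × ℕ) × (ℕ × Bool) => x.1.2 := Primrec.snd.comp Primrec.fst
  have hp : Primrec fun x : (List ℕ × ℕ) × (ℕ × Bool) => x.2.1 := Primrec.fst.comp Primrec.snd
  have hb : Primrec fun x : (List ℕ × ℕ) × (ℕ × Bool) => x.2.2 := Primrec.snd.comp Primrec.snd
  refine Primrec.pair (Primrec.pair (Primrec₂.natPair.comp (Primrec.const 0)
    (Primrec₂.natPair.comp hp hj)) (Primrec.pair (Primrec.const 0) hb)) ?_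
  refine Primrec.ite (Primrec.nat_lt.comp hj (Primrec.list_length.comp hw)) ?_ ?_
  · exact Primrec.pair (Primrec₂.natPair.comp (Primrec.const 0)
      (Primrec₂.natPair.comp hp (Primrec.succ.comp hj)))
      (Primrec.pair ((Primrec.list_getD 0).comp hw hj) (Primrec.const _))
  · exact Primrec.pair (Primrec₂.natPair.comp (Primrec.const 1)
      (Primrec₂.natPair.comp hp (Primrec.const _))) (Primrec.const _)

/-- Only the rules that write the input depend on it. The core rules and the endings are fixed
finite lists, hence constants, even though the former are obtained by choice. -/
theorem primrec_adversary : Primrec E.adversary :=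
  (Primrec.of_equiv_symm (e := Adversary.equiv)).comp <|
    (Primrec.list_append.comp E.primrec_writeRules (Primrec.const _)).pair (Primrec.const endings)

theorem exists_of_mem_rules {w : List ℕ} {r : Rule} (hr : r ∈ (E.adversary w).rules) :
    ∃ ph s a b, E.Occurs s ∧ E.rule w ph s a b = some r := by
  rcases List.mem_append.1 hr with h | h
  · obtain ⟨j, -, p, -, h⟩ := E.mem_writeRules_iff.1 h
    exact ⟨_, _, _, _, show E.Occurs (.write j) from trivial, h⟩
  · obtain ⟨p, -, s, hs, a, -, h⟩ := (E.mem_coreRules_iff w).1 h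
    exact ⟨_, _, _, _, hs.1, h⟩

theorem mem_rules {w : List ℕ} {ph : ℕ} {s : SimState Λ} {a : ℕ} {b : Bool} {r : Rule}
    (hph : ph < 4) (hs : E.Occurs s) (ha : a < E.bound) (h : E.rule w ph s a b = some r) :
    r ∈ (E.adversary w).rules := by
  by_cases hw : ∃ j, s = .write j
  · obtain ⟨j, rfl⟩ := hw
    have h' := h
    simp only [rule, trans, Option.map_eq_some_iff, Option.ite_none_right_eq_some] at h'
    obtain ⟨-, ⟨⟨rfl, hj⟩, -⟩, -⟩ := h'
    exact List.mem_append_left _ (E.mem_writeRules_iff.2 ⟨j, hj, (ph, b), mem_phaseClocks hph b, h⟩)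
  · exact List.mem_append_right _ ((E.mem_coreRules_iff w).2
      ⟨(ph, b), mem_phaseClocks hph b, s, ⟨hs, not_exists.1 hw⟩, a, ha, h⟩)

/-- A rule whose key matches must come from the same phase and state, by injectivity of `enc`, so it
does not matter which match is found first. A match exists whenever there is a transition, because
all symbols below `bound` are listed. -/
theorem step_adversary (w : List ℕ) {ph : ℕ} {s : SimState Λ} {tape : ℤ → ℕ} {pos clock : ℤ}
    {bud : ℕ} (hph : ph < 4) (hs : E.Occurs s) (ha : tape pos < E.bound) :
    (E.adversary w).step bud ⟨E.enc ph s, tape, pos, clock⟩ =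
      (E.trans w s (tape pos) (decide (0 ≤ clock ∧ clock < (bud : ℤ)))).map fun r =>
        ⟨E.enc ph r.1, Function.update tape pos r.2.1, pos + r.2.2.1.shift,
          clock + r.2.2.2.shift⟩ := by
  unfold Adversary.step
  simp only
  generalize decide (0 ≤ clock ∧ clock < (bud : ℤ)) = b
  cases hf : (E.adversary w).rules.find?
      fun r => decide (r.1 = (E.enc ph s, tape pos, b)) with
  | none =>
    cases ht : E.trans w s (tape pos) b with
    | none => rfl
    | some r =>
      have hr : E.rule w ph s (tape pos) b =
          some ((E.enc ph s, tape pos, b), (E.enc ph r.1, r.2)) := by rw [rule, ht]; rfl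
      simpa using List.find?_eq_none.1 hf _ (E.mem_rules hph hs ha hr)
  | some r =>
    have hkey : r.1 = (E.enc ph s, tape pos, b) := by simpa using List.find?_some hf
    obtain ⟨ph', s', a', b', hs', hr⟩ := E.exists_of_mem_rules (List.mem_of_find?_eq_some hf)
    rw [rule, Option.map_eq_some_iff] at hr
    obtain ⟨t, ht, rfl⟩ := hr
    simp only [Prod.mk.injEq] at hkey
    obtain ⟨rfl, rfl⟩ := E.enc_injOn hs' hs hkey.1
    rw [← hkey.2.1, ← hkey.2.2, ht]
    simp only [Option.map_some]

theorem ending_adversary (w : List ℕ) {ph : ℕ} (hph : ph < 4) (h : Bool) :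
    (E.adversary w).ending (E.enc ph (.left h)) =
      (E.enc ((ph + 1) % 4) (.write 0), if h then [] else [blockedPair ph]) := by
  simp only [Adversary.ending, adversary, enc]
  interval_cases ph <;> cases h <;> rfl

end Coding

/-! ### Composing computations of an adversary -/

theorem Adversary.stepsFrom_add {A : Adversary} {b : ℕ} {c c' c'' : Config} {i : ℕ}
    (h : A.stepsFrom b c i = some c') :
    ∀ {j : ℕ}, A.stepsFrom b c' j = some c'' → A.stepsFrom b c (i + j) = some c'' := by
  have : ∀ j, A.stepsFrom b c (i + j) = A.stepsFrom b c' j := fun j => by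
    induction j with
    | zero => exact h
    | succ j ih => rw [← add_assoc, stepsFrom, ih, stepsFrom]
  intro j hj
  rw [this, hj]

theorem Adversary.stepsFrom_succ {A : Adversary} {b : ℕ} {c c' c'' : Config} {i : ℕ}
    (h : A.stepsFrom b c i = some c') (h' : A.step b c' = some c'') :
    A.stepsFrom b c (i + 1) = some c'' := by
  rw [stepsFrom, h]; exact h'

@[simp] theorem HeadMove.shift_zero : HeadMove.shift 0 = -1 := rfl
@[simp] theorem HeadMove.shift_one : HeadMove.shift 1 = 0 := rfl
@[simp] theorem HeadMove.shift_two : HeadMove.shift 2 = 1 := rfl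

/-! ### Writing the input and running the machine -/

namespace Coding

open Turing

variable {Γ Λ : Type} [Inhabited Γ] [Inhabited Λ] {M : Turing.TM0.Machine Γ Λ} (E : Coding M)

/-- The tape after the first `j` symbols of `w` have been written from position `p` to the left. -/
def writtenTape (w : List ℕ) (p : ℤ) (j : ℕ) : ℤ → ℕ := fun z =>
  if p - j < z ∧ z ≤ p then w.getD (p - z).toNat 0 else 0

theorem stepsFrom_write (w : List ℕ) (bud : ℕ) {ph : ℕ} (hph : ph < 4) (p : ℤ) {j : ℕ}
    (hj : j ≤ w.length) :
    (E.adversary w).stepsFrom bud ⟨E.enc ph (.write 0), fun _ => 0, p, 0⟩ j =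
      some ⟨E.enc ph (.write j), writtenTape w p j, p - j, 0⟩ := by
  induction j with
  | zero =>
    have : writtenTape w p 0 = fun _ => 0 := by
      funext z
      exact if_neg (by push_cast; omega)
    simp [Adversary.stepsFrom, this]
  | succ j ih =>
    have h0 : writtenTape w p j (p - j) = 0 := if_neg (by omega)
    refine Adversary.stepsFrom_succ (ih (by omega)) ?_
    rw [E.step_adversary w hph (show E.Occurs (.write j) from trivial)
      (by rw [h0]; exact E.bound_pos), h0]
    simp only [trans, true_and, if_pos (show j ≤ w.length by omega), if_pos (show j < w.length from hj),
      Option.map_some, HeadMove.shift_zero, HeadMove.shift_one, Option.some.injEq, Config.mk.injEq]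
    refine ⟨?_, by push_cast; ring, by simp⟩
    funext z
    by_cases hz : z = p - j
    · subst hz
      have : (p - (p - (j : ℤ))).toNat = j := by omega
      rw [Function.update_self, writtenTape, if_pos (by push_cast; omega), this]
    · rw [Function.update_of_ne hz, writtenTape, writtenTape]
      refine if_congr ?_ rfl rfl
      push_cast; omega

/-- The adversary configuration `m` represents the configuration `c` of the machine after `i` steps:
the cells in use are those from `lo` to `hi - 1`. -/
structure Tracks (ph len i : ℕ) (c : TM0.Cfg Γ Λ) (m : Config) (lo hi : ℤ) : Prop where
  state_eq : m.state = E.enc ph (.run c.q)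
  mem_support : c.q ∈ E.support
  decode_tape : ∀ z, E.decode (m.tape (m.pos + z)) = c.Tape.nth z
  tape_lt : ∀ z, m.tape z < E.bound
  tape_ne_zero_iff : ∀ z, m.tape z ≠ 0 ↔ lo ≤ z ∧ z < hi
  lo_le : lo ≤ hi
  le_pos : lo - 1 ≤ m.pos
  pos_le : m.pos ≤ hi
  length_le : hi - lo ≤ len + i
  clock_eq : m.clock = i

theorem nth_mk₁ (x : List Γ) (z : ℤ) :
    (Tape.mk₁ x).nth z = if 0 ≤ z then x.getD z.toNat default else default := by
  have h := Tape.mk'_nth_nat (ListBlank.mk ([] : List Γ)) (ListBlank.mk x)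
  have hx : Tape.mk₁ x = Tape.mk' (ListBlank.mk []) (ListBlank.mk x) := rfl
  rw [hx]
  rcases z with n | n
  · simp only [Int.ofNat_eq_natCast, h, ListBlank.nth_mk]
    simp [List.getI_eq_getElem?_getD]
  · have : ¬ (0 : ℤ) ≤ Int.negSucc n := by omega
    rw [if_neg this]
    simp [Tape.nth, Tape.mk', ListBlank.nth_mk]

/-- The reversed input, as the adversary writes it. -/
def reversedInput (x : List Γ) : List ℕ := (x.map E.code).reverse

theorem stepsFrom_init (x : List Γ) (bud : ℕ) {ph : ℕ} (hph : ph < 4) (p : ℤ) :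
    ∃ m lo hi, (E.adversary (E.reversedInput x)).stepsFrom bud
        ⟨E.enc ph (.write 0), fun _ => 0, p, 0⟩ (x.length + 1) = some m ∧
      E.Tracks ph x.length 0 (TM0.init x) m lo hi := by
  set w := E.reversedInput x with hw
  have hlen : w.length = x.length := by simp [hw, reversedInput]
  have h0 : writtenTape w p x.length (p - x.length) = 0 := if_neg (by omega)
  have hget : ∀ k, k < x.length → ∃ a, x.getD (x.length - 1 - k) default = a ∧
      w.getD k 0 = E.code a := fun k hk => by
    refine ⟨_, rfl, ?_⟩
    rw [List.getD_eq_getElem _ _ (by omega), List.getD_eq_getElem _ _ (by omega)]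
    simp [hw, reversedInput]
  -- The input was written from right to left, so the head ends on the blank cell before its first
  -- symbol and has to move one cell to the right.
  refine ⟨⟨E.enc ph (.run default), writtenTape w p x.length, p - x.length + 1, 0⟩,
    p - x.length + 1, p + 1,
    Adversary.stepsFrom_succ (E.stepsFrom_write w bud hph p hlen.ge) ?_, ?_⟩
  · rw [E.step_adversary w hph (show E.Occurs (.write x.length) from trivial)
      (by rw [h0]; exact E.bound_pos), h0]
    simp only [trans, true_and, if_pos hlen.ge, if_neg hlen.not_gt,
      Option.map_some, HeadMove.shift_two, HeadMove.shift_one, Option.some.injEq, Config.mk.injEq]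
    exact ⟨(congrArg (Function.update _ _) h0.symm).trans (Function.update_eq_self _ _), by simp⟩
  · have hcode : ∀ z, p - x.length < z → z ≤ p → writtenTape w p x.length z =
        E.code (x.getD (z - (p - x.length + 1)).toNat default) := fun z h1 h2 => by
      obtain ⟨a, ha, ha'⟩ := hget (p - z).toNat (by omega)
      have : (z - (p - x.length + 1)).toNat = x.length - 1 - (p - z).toNat := by omega
      rw [writtenTape, if_pos ⟨h1, h2⟩, ha', this, ha]
    have hblank : ∀ z, ¬ (p - x.length < z ∧ z ≤ p) → writtenTape w p x.length z = 0 :=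
      fun z hz => if_neg hz
    constructor
    · rfl
    · exact E.supports.1
    · intro z
      simp only [TM0.init, nth_mk₁]
      by_cases hz : p - x.length < p - x.length + 1 + z ∧ p - x.length + 1 + z ≤ p
      · rw [hcode _ hz.1 hz.2, E.decode_code, if_pos (by omega)]
        congr 2; omega
      · rw [hblank _ hz, E.decode_zero]
        split_ifs with h
        · rw [List.getD_eq_default _ _ (by omega)]
        · rfl
    · intro z
      dsimp only
      by_cases hz : p - x.length < z ∧ z ≤ p
      · rw [hcode _ hz.1 hz.2]; exact E.code_lt _
      · rw [hblank _ hz]; exact E.bound_pos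
    · intro z
      dsimp only
      by_cases hz : p - x.length < z ∧ z ≤ p
      · rw [hcode _ hz.1 hz.2]
        exact iff_of_true (E.code_ne_zero _) (by omega)
      · rw [hblank _ hz]
        exact iff_of_false (by simp) (by omega)
    all_goals simp

/-- Rewriting a cell by the code of its decoded symbol marks it as visited without changing the tape
that it represents. -/
theorem decode_update (tape : ℤ → ℕ) (pos z : ℤ) :
    E.decode (Function.update tape pos (E.code (E.decode (tape pos))) z) = E.decode (tape z) := by
  by_cases h : z = pos
  · subst h; rw [Function.update_self, E.decode_code]
  · rw [Function.update_of_ne h]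

theorem update_code_lt {tape : ℤ → ℕ} (h : ∀ z, tape z < E.bound) (pos : ℤ) (a : Γ) (z : ℤ) :
    Function.update tape pos (E.code a) z < E.bound := by
  by_cases hz : z = pos
  · subst hz; rw [Function.update_self]; exact E.code_lt a
  · rw [Function.update_of_ne hz]; exact h z

/-- The head is inside the interval of non-blank cells or adjacent to it, so marking its cell leaves
an interval. -/
theorem update_code_ne_zero_iff {tape : ℤ → ℕ} {lo hi : ℤ}
    (h : ∀ z, tape z ≠ 0 ↔ lo ≤ z ∧ z < hi) {pos : ℤ} (h₁ : lo ≤ hi) (h₂ : lo - 1 ≤ pos)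
    (h₃ : pos ≤ hi) (a : Γ) (z : ℤ) :
    Function.update tape pos (E.code a) z ≠ 0 ↔ min lo pos ≤ z ∧ z < max hi (pos + 1) := by
  by_cases hz : z = pos
  · subst hz
    rw [Function.update_self]
    exact iff_of_true (E.code_ne_zero a) (by omega)
  · rw [Function.update_of_ne hz, h]
    omega

variable {E} in
theorem Tracks.head {ph len i : ℕ} {c : TM0.Cfg Γ Λ} {m : Config} {lo hi : ℤ}
    (h : E.Tracks ph len i c m lo hi) : E.decode (m.tape m.pos) = c.Tape.1 := by
  simpa using h.decode_tape 0

variable {E} in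
theorem Tracks.step_eq {ph len i : ℕ} {c : TM0.Cfg Γ Λ} {m : Config} {lo hi : ℤ}
    (h : E.Tracks ph len i c m lo hi) (hph : ph < 4) (w : List ℕ) (bud : ℕ) :
    (E.adversary w).step bud m =
      (E.trans w (.run c.q) (m.tape m.pos) (decide (i < bud))).map fun r =>
        ⟨E.enc ph r.1, Function.update m.tape m.pos r.2.1, m.pos + r.2.2.1.shift,
          i + r.2.2.2.shift⟩ := by
  obtain ⟨s, tape, pos, clock⟩ := m
  obtain rfl : s = _ := h.state_eq
  obtain rfl : clock = _ := h.clock_eq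
  rw [E.step_adversary w hph (show E.Occurs (.run c.q) from h.mem_support) (h.tape_lt _)]
  simp

variable {E} in
-- One machine step costs exactly one adversary step and one clock cell, and lengthens the interval
-- of visited cells by at most one.
theorem Tracks.succ {ph len i : ℕ} {c c' : TM0.Cfg Γ Λ} {m : Config} {lo hi : ℤ}
    (h : E.Tracks ph len i c m lo hi) (hph : ph < 4) (w : List ℕ) {bud : ℕ} (hi' : i < bud)
    (hc : TM0.step M c = some c') :
    ∃ m' lo' hi', (E.adversary w).step bud m = some m' ∧ E.Tracks ph len (i + 1) c' m' lo' hi' := by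
  have hstep := h.step_eq hph w bud
  obtain ⟨q, T⟩ := c
  simp only [TM0.step, Option.map_eq_some_iff] at hc
  obtain ⟨⟨q', s⟩, hM, rfl⟩ := hc
  simp only [trans, h.head, hM, hi', decide_true, if_true, Option.map_some] at hstep
  refine ⟨_, min lo m.pos, max hi (m.pos + 1), hstep, ?_⟩
  have h₁ := h.lo_le
  have h₂ := h.le_pos
  have h₃ := h.pos_le
  have h₄ := h.length_le
  have hmem : q' ∈ E.support := E.supports.2 hM h.mem_support
  cases s with
  | move d =>
    cases d
    · refine ⟨rfl, hmem, fun z => ?_, E.update_code_lt h.tape_lt _ _,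
        E.update_code_ne_zero_iff h.tape_ne_zero_iff h₁ h₂ h₃ _, ?_, ?_, ?_, ?_, ?_⟩
      · simp only [action, Tape.move_left_nth, E.decode_update, HeadMove.shift_zero]
        rw [← h.decode_tape]; congr 2; ring
      all_goals (try simp only [action, HeadMove.shift_zero, HeadMove.shift_two]); push_cast; omega
    · refine ⟨rfl, hmem, fun z => ?_, E.update_code_lt h.tape_lt _ _,
        E.update_code_ne_zero_iff h.tape_ne_zero_iff h₁ h₂ h₃ _, ?_, ?_, ?_, ?_, ?_⟩
      · simp only [action, Tape.move_right_nth, E.decode_update, HeadMove.shift_two]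
        rw [← h.decode_tape]; congr 2; ring
      all_goals (try simp only [action, HeadMove.shift_two]); push_cast; omega
  | write a =>
    refine ⟨rfl, hmem, fun z => ?_, E.update_code_lt h.tape_lt _ _,
      E.update_code_ne_zero_iff h.tape_ne_zero_iff h₁ h₂ h₃ _, ?_, ?_, ?_, ?_, ?_⟩
    · simp only [action, Tape.write_nth, HeadMove.shift_one, add_zero]
      by_cases hz : z = 0
      · subst hz; simp [E.decode_code]
      · rw [Function.update_of_ne (by simpa using hz), if_neg hz, h.decode_tape]
    all_goals (try simp only [action, HeadMove.shift_one, HeadMove.shift_two]); push_cast; omega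

theorem stepsFrom_run (x : List Γ) (bud : ℕ) {ph : ℕ} (hph : ph < 4) (p : ℤ) {i : ℕ}
    (hi : i ≤ bud) {c : TM0.Cfg Γ Λ} (hc : tmSteps M x i = some c) :
    ∃ m lo hi, (E.adversary (E.reversedInput x)).stepsFrom bud
        ⟨E.enc ph (.write 0), fun _ => 0, p, 0⟩ (x.length + 1 + i) = some m ∧
      E.Tracks ph x.length i c m lo hi := by
  induction i generalizing c with
  | zero =>
    obtain rfl : TM0.init x = c := Option.some.inj hc
    exact E.stepsFrom_init x bud hph p
  | succ i ih =>
    rw [tmSteps, Option.bind_eq_some_iff] at hc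
    obtain ⟨c₀, hc₀, hc⟩ := hc
    obtain ⟨m, lo, hi', hm, ht⟩ := ih (by omega) hc₀
    obtain ⟨m', lo', hi'', hm', ht'⟩ := ht.succ hph (E.reversedInput x) hi hc
    exact ⟨m', lo', hi'', Adversary.stepsFrom_succ hm hm', ht'⟩

end Coding

/-- This yields the configuration in which the simulation stops: a halting one, or the one after `k`
steps when the budget is exhausted. -/
theorem exists_tmSteps {Γ Λ : Type} [Inhabited Γ] [Inhabited Λ] (M : Turing.TM0.Machine Γ Λ)
    (x : List Γ) (k : ℕ) [Decidable (HaltsWithin M x k)] :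
    ∃ i ≤ k, ∃ c, tmSteps M x i = some c ∧
      (Turing.TM0.step M c = none ∧ HaltsWithin M x k ∨
        i = k ∧ Turing.TM0.step M c ≠ none ∧ ¬ HaltsWithin M x k) := by
  by_cases h : HaltsWithin M x k
  · obtain ⟨i, hi, c, hc, hs⟩ := h
    exact ⟨i, hi, c, hc, .inl ⟨hs, ⟨i, hi, c, hc, hs⟩⟩⟩
  · have : ∀ i ≤ k, ∃ c, tmSteps M x i = some c := fun i => by
      induction i with
      | zero => exact fun _ => ⟨_, rfl⟩
      | succ i ih =>
        intro hi
        obtain ⟨c, hc⟩ := ih (by omega)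
        cases hs : Turing.TM0.step M c with
        | none => exact absurd ⟨i, by omega, c, hc, hs⟩ h
        | some c' => exact ⟨c', by rw [tmSteps, hc]; exact hs⟩
    obtain ⟨c, hc⟩ := this k le_rfl
    exact ⟨k, le_rfl, c, hc, .inr ⟨rfl, fun hs => h ⟨k, le_rfl, c, hc, hs⟩, h⟩⟩

theorem Adversary.stepsFrom_of_step {A : Adversary} {b : ℕ} {c c' c'' : Config} {i : ℕ}
    (h : A.step b c = some c') (h' : A.stepsFrom b c' i = some c'') :
    A.stepsFrom b c (i + 1) = some c'' := by
  rw [add_comm]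
  exact stepsFrom_add (stepsFrom_succ (i := 0) rfl h) h'

/-! ### Erasing the tape and completing a round -/

namespace Coding

open Turing

variable {Γ Λ : Type} [Inhabited Γ] [Inhabited Λ] {M : Turing.TM0.Machine Γ Λ} (E : Coding M)

/-- There are `k` moves to the first blank cell on the right, and one more step to turn around. -/
theorem stepsFrom_right (w : List ℕ) (bud : ℕ) {ph : ℕ} (hph : ph < 4) (h : Bool) {tape : ℤ → ℕ}
    {lo hi clock : ℤ} (ht : ∀ z, tape z < E.bound) (hz : ∀ z, tape z ≠ 0 ↔ lo ≤ z ∧ z < hi) (k : ℕ)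
    {pos : ℤ} (hk : hi - pos = k) (hpos : lo ≤ pos) :
    (E.adversary w).stepsFrom bud ⟨E.enc ph (.right h), tape, pos, clock⟩ (k + 1) =
      some ⟨E.enc ph (.left h), tape, hi - 1, clock⟩ := by
  have hstep := E.step_adversary w (clock := clock) (bud := bud) hph
    (show E.Occurs (.right h) from trivial) (ht pos)
  induction k generalizing pos with
  | zero =>
    obtain rfl : pos = hi := by simp at hk; omega
    have h0 : tape pos = 0 := by
      by_contra h0
      exact absurd ((hz _).1 h0).2 (lt_irrefl _)
    refine Adversary.stepsFrom_of_step hstep ?_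
    simp only [h0, if_true, Adversary.stepsFrom, HeadMove.shift_zero, HeadMove.shift_one,
      Option.some.injEq, Config.mk.injEq, true_and]
    exact ⟨(congrArg (Function.update _ _) h0.symm).trans (Function.update_eq_self _ _), rfl,
      add_zero _⟩
  | succ k ih =>
    push_cast at hk
    refine Adversary.stepsFrom_of_step ?_ (ih (pos := pos + 1) (by omega) (by omega)
      (E.step_adversary w hph (show E.Occurs (.right h) from trivial) (ht _)))
    have h0 : tape pos ≠ 0 := (hz _).2 (by omega)
    rw [hstep]
    simp [trans, h0]

theorem stepsFrom_left (w : List ℕ) (bud : ℕ) {ph : ℕ} (hph : ph < 4) (h : Bool) {tape : ℤ → ℕ}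
    {lo hi clock : ℤ} (ht : ∀ z, tape z < E.bound) (hz : ∀ z, tape z ≠ 0 ↔ lo ≤ z ∧ z < hi) (k : ℕ)
    (hk : hi - lo = k) :
    (E.adversary w).stepsFrom bud ⟨E.enc ph (.left h), tape, hi - 1, clock⟩ k =
      some ⟨E.enc ph (.left h), fun _ => 0, lo - 1, clock⟩ := by
  induction k generalizing tape hi with
  | zero =>
    obtain rfl : hi = lo := by simp at hk; omega
    have : tape = fun _ => 0 := by
      funext z
      by_contra h0
      have := (hz z).1 h0
      omega
    rw [this]; rfl
  | succ k ih =>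
    push_cast at hk
    have h0 : tape (hi - 1) ≠ 0 := (hz _).2 (by omega)
    refine Adversary.stepsFrom_of_step ?_
      (ih (tape := Function.update tape (hi - 1) 0) (hi := hi - 1) (fun z => ?_) (fun z => ?_)
        (by omega))
    · rw [E.step_adversary w hph (show E.Occurs (.left h) from trivial) (ht _)]
      simp [trans, h0, ← sub_eq_add_neg]
    · by_cases hzz : z = hi - 1
      · subst hzz; rw [Function.update_self]; exact E.bound_pos
      · rw [Function.update_of_ne hzz]; exact ht z
    · by_cases hzz : z = hi - 1
      · subst hzz; rw [Function.update_self]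
        exact iff_of_false (by simp) (by omega)
      · rw [Function.update_of_ne hzz, hz]; omega

theorem step_left_blank (w : List ℕ) (bud : ℕ) {ph : ℕ} (hph : ph < 4) (h : Bool) (pos clock : ℤ) :
    (E.adversary w).step bud ⟨E.enc ph (.left h), fun _ => 0, pos, clock⟩ = none := by
  rw [E.step_adversary w hph (show E.Occurs (.left h) from trivial) E.bound_pos]
  simp [trans]

variable {E} in
-- The transition function tests for halting before it looks at the clock, so a machine that halts
-- after exactly `bud` steps is still recognised. The current cell is marked as visited, which makes
-- it part of the interval to be erased.
theorem Tracks.step_to_right {ph len i : ℕ} {c : TM0.Cfg Γ Λ} {m : Config} {lo hi : ℤ}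
    (ht : E.Tracks ph len i c m lo hi) (hph : ph < 4) (w : List ℕ) {bud : ℕ} {h : Bool}
    (hfinal : TM0.step M c = none ∧ h = true ∨ i = bud ∧ TM0.step M c ≠ none ∧ h = false) :
    (E.adversary w).step bud m = some ⟨E.enc ph (.right h),
      Function.update m.tape m.pos (E.code (E.decode (m.tape m.pos))), m.pos, i⟩ := by
  have hstep := ht.step_eq hph w bud
  obtain ⟨q, T⟩ := c
  rw [hstep, trans, ht.head]
  simp only [TM0.step, ne_eq, Option.map_eq_none_iff] at hfinal
  rcases hfinal with ⟨hM, rfl⟩ | ⟨rfl, hM, rfl⟩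
  · simp [hM]
  · obtain ⟨r, hr⟩ := Option.ne_none_iff_exists'.1 hM
    simp [hr]

theorem exists_stepsFrom_round (x : List Γ) (bud : ℕ) [Decidable (HaltsWithin M x bud)] {ph : ℕ}
    (hph : ph < 4) (p : ℤ) :
    ∃ t ≤ 3 * (x.length + bud) + 6, ∃ pos clock,
      (E.adversary (E.reversedInput x)).stepsFrom bud
        ⟨E.enc ph (.write 0), fun _ => 0, p, 0⟩ t =
          some ⟨E.enc ph (.left (decide (HaltsWithin M x bud))), fun _ => 0, pos, clock⟩ := by
  obtain ⟨i, hi, c, hc, hfinal⟩ := exists_tmSteps M x bud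
  obtain ⟨m, lo, hi', hm, ht⟩ := E.stepsFrom_run x bud hph p hi hc
  set w := E.reversedInput x
  have h₁ := ht.lo_le
  have h₂ := ht.le_pos
  have h₃ := ht.pos_le
  have h₄ := ht.length_le
  have hs := ht.step_to_right hph w (bud := bud) (h := decide (HaltsWithin M x bud)) (by simpa using hfinal)
  have htape := E.update_code_lt ht.tape_lt m.pos (E.decode (m.tape m.pos))
  have hnz := E.update_code_ne_zero_iff ht.tape_ne_zero_iff h₁ h₂ h₃ (E.decode (m.tape m.pos))
  have hr := E.stepsFrom_right w bud hph (decide (HaltsWithin M x bud)) (clock := i) htape hnz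
    (max hi' (m.pos + 1) - m.pos).toNat (pos := m.pos) (by omega) (by omega)
  have hl := E.stepsFrom_left w bud hph (decide (HaltsWithin M x bud)) (clock := i) htape hnz
    (max hi' (m.pos + 1) - min lo m.pos).toNat (by omega)
  -- Writing takes `x.length + 1` steps and the machine at most `bud`; the two erasing passes cross
  -- at most `x.length + bud + 1` cells each, and there are two further steps for the changes of
  -- direction.
  exact ⟨_, by omega, _, _, Adversary.stepsFrom_add
    (Adversary.stepsFrom_add (Adversary.stepsFrom_succ hm hs) hr) hl⟩

/-- The simulating adversary has a run with linear time per round and a blank tape between rounds. -/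
theorem exists_run (x : List Γ) (f : ℕ → ℕ) (quiet : ℕ → Bool)
    (hq : ∀ n, quiet n = true ↔ HaltsWithin M x (f n)) :
    ∃ R : (E.adversary (E.reversedInput x)).Run f,
      (∀ n, R.time n ≤ 3 * (x.length + f n) + 6) ∧ (∀ n, (R.start n).tape = fun _ => 0) ∧
      R.delay 3 = triangleDelay quiet := by
  classical
  have hmod : ∀ n, n % 4 < 4 := fun n => Nat.mod_lt _ (by norm_num)
  have key := fun n (p : ℤ) => E.exists_stepsFrom_round x (f n) (hmod n) p
  have hquiet : ∀ n, decide (HaltsWithin M x (f n)) = quiet n := fun n => by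
    rw [Bool.eq_iff_iff, decide_eq_true_iff, hq]
  simp only [hquiet] at key
  choose time htime pos clock hrun using key
  -- The work head does not return to the origin: each round starts where the erasing of the
  -- previous one stopped.
  set P : ℕ → ℤ := fun n => Nat.rec 0 (fun n p => pos n p) n with hP
  have hE : ∀ n, (E.adversary (E.reversedInput x)).ending (E.enc (n % 4) (.left (quiet n))) =
      (E.enc ((n + 1) % 4) (.write 0), if quiet n then [] else [blockedPair (n % 4)]) := fun n => by
    rw [E.ending_adversary _ (hmod n), Nat.mod_add_mod]
  refine ⟨⟨fun n => ⟨E.enc (n % 4) (.write 0), fun _ => 0, P n, 0⟩,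
    fun n => ⟨E.enc (n % 4) (.left (quiet n)), fun _ => 0, pos n (P n), clock n (P n)⟩,
    fun n => time n (P n), rfl, fun n => hrun n (P n),
    fun n => E.step_left_blank _ _ (hmod n) _ _ _, fun n => ?_⟩,
    fun n => htime _ _, fun n => rfl, ?_⟩
  · simp only [Adversary.nextRound, hE]
    rfl
  · funext n v u
    simp only [Adversary.Run.delay, hE, triangleDelay]
    cases quiet n <;> simp

end Coding

/-! ### Admissibility of the simulating adversary -/

theorem Adversary.Run.withinBudget_of_blank {A : Adversary} {f : ℕ → ℕ} (R : A.Run f)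
    (hf : Tendsto f atTop atTop) (K : ℕ) (ht : ∀ n, R.time n ≤ 3 * (K + f n) + 6)
    (hb : ∀ n, (R.start n).tape = fun _ => 0) : R.WithinBudget := by
  refine ⟨3 * K + 10, ?_⟩
  filter_upwards [hf.eventually_ge_atTop 1] with n hn
  -- The extra `1` is for the cells: `t` steps visit at most `t + 1` of them, and the tape is blank
  -- when the round starts.
  have hmul : 3 * (K + f n) + 6 + 1 ≤ (3 * K + 10) * f n := by nlinarith
  refine ⟨by have := ht n; omega, ?_⟩
  have hsub : R.cells n ⊆ (fun i => ((A.stepsFrom (f n) (R.start n) i).getD (R.start n)).pos) ''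
      (Finset.range (R.time n + 1) : Set ℕ) := by
    rintro z (hz | ⟨i, hi, c, hc, rfl⟩)
    · simp [hb] at hz
    · exact ⟨i, by simpa [Nat.lt_succ_iff] using hi, by simp [hc]⟩
  refine (Set.encard_le_encard hsub).trans ((Set.encard_image_le _ _).trans ?_)
  rw [Set.encard_coe_eq_coe_finsetCard, Finset.card_range, Nat.cast_le]
  have := ht n
  omega

theorem HaltsWithin.mono {Γ Λ : Type} [Inhabited Γ] [Inhabited Λ]
    {M : Turing.TM0.Machine Γ Λ} {x : List Γ} {s t : ℕ} (hst : s ≤ t) (h : HaltsWithin M x s) :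
    HaltsWithin M x t :=
  let ⟨i, hi, hc⟩ := h
  ⟨i, hi.trans hst, hc⟩

/-- The argument is not uniform in the input: if the machine halts, compare its halting time, a
constant, with `f n`; otherwise no round is quiet. Monotonicity of `f` plays no role. -/
theorem exists_computable_quiet {Γ Λ : Type} [Inhabited Γ] [Inhabited Λ]
    (M : Turing.TM0.Machine Γ Λ) (x : List Γ) {f : ℕ → ℕ} (hf : Computable f) :
    ∃ quiet : ℕ → Bool, Computable quiet ∧ ∀ n, quiet n = true ↔ HaltsWithin M x (f n) := by
  classical
  by_cases h : ∃ t, HaltsWithin M x t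
  · refine ⟨fun n => decide (Nat.find h ≤ f n),
      Primrec.nat_le.decide.to_comp.comp (Computable.const _) hf, fun n => ?_⟩
    rw [decide_eq_true_iff]
    exact ⟨fun hn => (Nat.find_spec h).mono hn, fun hn => Nat.find_min' h hn⟩
  · exact ⟨fun _ => false, Computable.const _, fun n => by
      simpa using fun hn => h ⟨_, hn⟩⟩

theorem computable_triangleDelay {quiet : ℕ → Bool} (h : Computable quiet) :
    Computable fun p : ℕ × Fin 3 × Fin 3 => triangleDelay quiet p.1 p.2.1 p.2.2 := by
  have hfin : Primrec fun p : Fin 4 × Fin 3 × Fin 3 =>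
      decide ((p.2.1.val, p.2.2.val) = blockedPair p.1.val) := Primrec.dom_finite _
  have hmod : Primrec fun p : ℕ × Fin 3 × Fin 3 =>
      (⟨p.1 % 4, Nat.mod_lt _ (by norm_num)⟩ : Fin 4) :=
    Primrec.fin_val_iff.1 (Primrec.nat_mod.comp Primrec.fst (Primrec.const 4))
  exact (Primrec.and.to_comp).comp (Primrec.not.to_comp.comp (h.comp Computable.fst))
    (hfin.comp (hmod.pair Primrec.snd)).to_comp

theorem Coding.exists_admissible_run {Γ Λ : Type} [Inhabited Γ] [Inhabited Λ]
    {M : Turing.TM0.Machine Γ Λ} (E : Coding M) {f : ℕ → ℕ} (hf : Computable f)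
    (hlim : Tendsto f atTop atTop) (x : List Γ) :
    ∃ R : (E.adversary (E.reversedInput x)).Run f,
      R.Admissible (⊤ : SimpleGraph (Fin 3)) ∧
      (∀ n, (∀ v u : Fin 3, v ≠ u → R.delay 3 n v u = false) ↔ HaltsWithin M x (f n)) ∧
      (Terminates (⊤ : SimpleGraph (Fin 3)) 0 (R.delay 3) ↔ ∃ t, HaltsWithin M x t) := by
  obtain ⟨quiet, hc, hq⟩ := exists_computable_quiet M x hf
  obtain ⟨R, ht, hb, hd⟩ := E.exists_run x f quiet hq
  refine ⟨R, ⟨R.withinBudget_of_blank hlim _ ht hb, ?_, ?_⟩, fun n => ?_, ?_⟩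
  · rw [hd]; exact computable_triangleDelay hc
  · rw [hd]; exact finiteDelay_triangleDelay quiet
  · rw [hd, triangleDelay_eq_false_iff, hq]
  · rw [hd]
    constructor
    · intro h
      by_contra hn
      refine not_terminates_triangle_of_not_quiet (fun n => ?_) h
      rw [← Bool.not_eq_true, hq]
      exact fun h => hn ⟨_, h⟩
    · rintro ⟨t, h⟩
      refine terminates_triangle_of_eventually_quiet ?_
      filter_upwards [hlim.eventually_ge_atTop t] with n hn
      exact (hq n).2 (h.mono hn)

/-- Every machine over a finite alphabet with finite support has a coding. -/
theorem Coding.exists_of_supports {Γ Λ : Type} [Inhabited Γ] [Finite Γ] [Inhabited Λ]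
    (M : Turing.TM0.Machine Γ Λ) (S : Finset Λ) (hS : Turing.TM0.Supports M (S : Set Λ))
    (code : Γ → ℕ) (hcode : Function.Injective code) :
    ∃ E : Coding M, E.code = fun a => code a + 1 := by
  obtain ⟨label, hlabel⟩ := Set.countable_iff_exists_injOn.1 S.countable_toSet
  obtain ⟨K, hK⟩ := (Set.finite_range code).bddAbove
  -- The shift by one keeps `0` free for the cells not yet visited.
  refine ⟨⟨fun a => code a + 1, fun n => if n = 0 then default else Function.invFun code (n - 1),
    K + 2, S, label, fun a => ?_, if_pos rfl, fun a => Nat.succ_ne_zero _, fun a => ?_, hS,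
    hlabel⟩, rfl⟩
  · simp [Function.leftInverse_invFun hcode a]
  · have := hK ⟨a, rfl⟩
    omega

theorem canSimulate {f : ℕ → ℕ} (hf : Computable f) (hlim : Tendsto f atTop atTop) :
    CanSimulate f := by
  intro k Λ _ _ M
  classical
  have := Fintype.ofFinite Λ
  obtain ⟨E, hE⟩ := Coding.exists_of_supports M Finset.univ
    (by simpa using Turing.TM0.univ_supports M) Fin.val Fin.val_injective
  refine ⟨fun x => E.adversary (E.reversedInput x), ?_, E.exists_admissible_run hf hlim⟩
  refine E.primrec_adversary.to_comp.comp (Primrec.to_comp ?_)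
  refine Primrec.list_reverse.comp (Primrec.list_map Primrec.id ?_)
  rw [hE]
  exact Primrec.succ.comp (Primrec.fin_val.comp Primrec.snd)

/-! ## Undecidability -/

theorem reaches_iff_exists_tmSteps {Γ Λ : Type} [Inhabited Γ] [Inhabited Λ]
    (M : Turing.TM0.Machine Γ Λ) (x : List Γ) (c : Turing.TM0.Cfg Γ Λ) :
    StateTransition.Reaches (Turing.TM0.step M) (Turing.TM0.init x) c ↔
      ∃ i, tmSteps M x i = some c := by
  constructor
  · intro h
    induction h with
    | refl => exact ⟨0, rfl⟩
    | tail _ hs ih =>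
      obtain ⟨i, hi⟩ := ih
      exact ⟨i + 1, by rw [tmSteps, hi]; exact hs⟩
  · rintro ⟨i, hi⟩
    induction i generalizing c with
    | zero =>
      obtain rfl : Turing.TM0.init x = c := Option.some.inj hi
      exact .refl
    | succ i ih =>
      rw [tmSteps, Option.bind_eq_some_iff] at hi
      obtain ⟨c', hc', hs⟩ := hi
      exact (ih c' hc').tail hs

theorem eval_dom_iff_haltsWithin {Γ Λ : Type} [Inhabited Γ] [Inhabited Λ]
    (M : Turing.TM0.Machine Γ Λ) (x : List Γ) :
    (Turing.TM0.eval M x).Dom ↔ ∃ t, HaltsWithin M x t := by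
  rw [Turing.TM0.eval, Part.map_Dom, Part.dom_iff_mem]
  simp only [StateTransition.mem_eval, reaches_iff_exists_tmSteps]
  constructor
  · rintro ⟨c, ⟨i, hi⟩, hs⟩
    exact ⟨i, i, le_rfl, c, hi, hs⟩
  · rintro ⟨t, i, -, c, hi, hs⟩
    exact ⟨c, ⟨i, hi⟩, hs⟩

/-! ### Reduction of the halting problem to the termination problem -/

theorem terminates_congr {N : ℕ} {G G' : SimpleGraph (Fin N)} [hG : DecidableRel G.Adj]
    [hG' : DecidableRel G'.Adj] (h : G = G') (g₀ : Fin N) (d : DelayFun (Fin N)) :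
    Terminates G g₀ d ↔ Terminates G' g₀ d := by
  subst h
  rw [Subsingleton.elim hG hG']

/-- The triangle with source `0`, with a given adversary. -/
def triangleInput (A : Adversary) : Input := ⟨3, [(0, 1), (0, 2), (1, 2)], 0, A⟩

theorem graph_triangleInput (A : Adversary) :
    (triangleInput A).graph = (⊤ : SimpleGraph (Fin 3)) := by
  ext u v
  change Fin 3 at u v
  rw [SimpleGraph.top_adj, Input.graph]
  refine (SimpleGraph.fromRel_adj _ _ _).trans ?_
  simp only [triangleInput]
  revert u v
  decide

theorem terminates_triangleInput (A : Adversary) (g₀ : Fin 3) (d : DelayFun (Fin 3)) :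
    Terminates (V := Fin (triangleInput A).order) (triangleInput A).graph g₀ d ↔
      Terminates (⊤ : SimpleGraph (Fin 3)) g₀ d :=
  terminates_congr (N := (triangleInput A).order)
    (hG' := (inferInstance : DecidableRel (⊤ : SimpleGraph (Fin 3)).Adj))
    (graph_triangleInput A) g₀ d

theorem primrec_triangleInput : Primrec triangleInput :=
  (Primrec.of_equiv_symm (e := Input.equiv)).comp <|
    (Primrec.const 3).pair <| (Primrec.const [(0, 1), (0, 2), (1, 2)]).pair <|
      (Primrec.const 0).pair Primrec.id

/-- A decider may diverge on inadmissible inputs, but every input of the reduction is admissible, so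
its composition with the reduction is total and would decide halting. -/
theorem Coding.terminationUndecidable {Γ Λ : Type} [Inhabited Γ] [Inhabited Λ]
    {M : Turing.TM0.Machine Γ Λ} (E : Coding M) {f : ℕ → ℕ} (hf : Computable f)
    (hlim : Tendsto f atTop atTop) (input : ℕ → List Γ)
    (hin : Computable fun n => E.reversedInput (input n))
    (hund : ¬ ComputablePred fun n => ∃ t, HaltsWithin M (input n) t) :
    TerminationUndecidable f := by
  rintro ⟨D, hD, hdec⟩
  refine hund ⟨fun _ => Classical.propDecidable _, ?_⟩
  have hc : Computable fun n => triangleInput (E.adversary (E.reversedInput (input n))) :=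
    (primrec_triangleInput.comp E.primrec_adversary).to_comp.comp hin
  refine Partrec.of_eq_tot (hD.comp hc) fun n => ?_
  obtain ⟨R, hadm, -, hterm⟩ := E.exists_admissible_run hf hlim (input n)
  have hG := graph_triangleInput (E.adversary (E.reversedInput (input n)))
  obtain ⟨b, hb, hbt⟩ := hdec (triangleInput (E.adversary (E.reversedInput (input n))))
    (0 : Fin 3) R rfl (by rw [hG]; exact SimpleGraph.connected_top (V := Fin 3)) (by rw [hG]; exact hadm)
  have hbt' : b = true ↔ ∃ t, HaltsWithin M (input n) t :=
    hbt.trans ((terminates_triangleInput _ 0 (R.delay 3)).trans hterm)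
  convert hb
  rw [Bool.eq_iff_iff, @decide_eq_true_iff _ (Classical.propDecidable _), hbt']

/-! ### A machine with undecidable halting problem on simple inputs -/

/-- The number `2 ^ n - 1`, with `n` binary digits `1`. -/
def allOnes (n : ℕ) : ℕ := Nat.rec 0 (fun _ m => 2 * m + 1) n

theorem primrec_allOnes : Primrec allOnes :=
  Primrec.nat_rec₁ 0 (Primrec.succ.comp
    (Primrec.nat_mul.comp (Primrec.const 2) Primrec.snd)).to₂

/-- This is why the numbers `2 ^ n - 1` are used: their binary encoding repeats a single symbol, so
the family of machine inputs is obviously computable. -/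
theorem trNat_allOnes (n : ℕ) :
    Turing.PartrecToTM2.trNat (allOnes n) = List.replicate n Turing.PartrecToTM2.Γ'.bit1 := by
  induction n with
  | zero => exact Turing.PartrecToTM2.trNat_zero
  | succ n ih =>
    rw [List.replicate_succ, ← ih]
    simp only [Turing.PartrecToTM2.trNat]
    have : ((allOnes (n + 1) : ℕ) : Num) = Num.bit1 (allOnes n : Num) := by
      rw [← Num.ofNat'_eq, ← Num.ofNat'_eq]
      have h : allOnes (n + 1) = Nat.bit true (allOnes n) := by
        simp [allOnes, Nat.bit_val]
      rw [h, Num.ofNat'_bit]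
      rfl
    rw [this]
    cases (allOnes n : Num) <;> rfl

theorem allOnes_injective : Function.Injective allOnes := fun n m h => by
  simpa [trNat_allOnes] using congrArg (fun k => (Turing.PartrecToTM2.trNat k).length) h

/-- A partial recursive function whose domain, at the numbers `allOnes n`, is the halting
problem. -/
theorem exists_code_halting : ∃ c : Turing.ToPartrec.Code, ∀ n,
    (c.eval [allOnes n]).Dom ↔ ((Denumerable.ofNat Nat.Partrec.Code n).eval 0).Dom := by
  have hg : Partrec fun n => (Denumerable.ofNat Nat.Partrec.Code n).eval 0 :=
    Nat.Partrec.Code.eval_part.comp (Computable.ofNat _) (Computable.const 0)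
  -- Unbounded search inverts `allOnes`; it diverges at numbers of any other form.
  have hr : Partrec fun m : ℕ => Nat.rfind fun n => Part.some (decide (allOnes n = m)) := by
    refine Partrec.rfind (Computable.partrec ?_)
    exact (Primrec.eq.decide.comp (primrec_allOnes.comp Primrec.snd) Primrec.fst).to_comp
  obtain ⟨c, hc⟩ := Turing.ToPartrec.Code.exists_code
    (Nat.Partrec'.part_iff₁.2 (hr.bind (hg.comp Computable.snd).to₂))
  refine ⟨c, fun n => ?_⟩
  have h := hc ⟨[allOnes n], rfl⟩
  have hn : (Nat.rfind fun k => Part.some (decide (allOnes k = allOnes n))) = Part.some n := by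
    refine Part.eq_some_iff.2 (Nat.mem_rfind.2 ⟨by simp, fun {m} hm => ?_⟩)
    simpa using fun h => hm.ne (allOnes_injective h)
  change c.eval [allOnes n] = pure <$> Part.bind
    (Nat.rfind fun k => Part.some (decide (allOnes k = allOnes n))) _ at h
  rw [h, hn]
  simp

/-- The symbol of the one-tape simulation of the four-stack machine that has `s` on the main
stack. -/
def mainSymbol (bottom : Bool) (s : Turing.PartrecToTM2.Γ') :
    Turing.TM2to1.Γ' Turing.PartrecToTM2.K' fun _ => Turing.PartrecToTM2.Γ' :=
  (bottom, Function.update (fun _ => none) .main (some s))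

theorem trInit_allOnes (n : ℕ) :
    Turing.TM2to1.trInit (Γ := fun _ => Turing.PartrecToTM2.Γ') Turing.PartrecToTM2.K'.main
      (Turing.PartrecToTM2.trList [allOnes n]) =
      mainSymbol true .cons :: List.replicate n (mainSymbol false .bit1) := by
  have : (Turing.PartrecToTM2.trList [allOnes n]).reverse =
      .cons :: List.replicate n Turing.PartrecToTM2.Γ'.bit1 := by
    simp [trNat_allOnes]
  rw [Turing.TM2to1.trInit, this, ← List.map_replicate]
  rfl

instance : Finite Turing.PartrecToTM2.K' :=
  Set.finite_univ_iff.1 ((Set.toFinite {.main, .rev, .aux, .stack}).subset fun k _ => by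
    cases k <;> simp)

/-- The machine comes from a recursive code through the four-stack, one-tape and elementary models,
each translation preserving halting. Its label type need not be finite, but a finite set of labels
supports it. -/
theorem exists_undecidable_machine : ∃ (Γ Λ : Type) (_ : Inhabited Γ) (_ : Finite Γ)
    (_ : Inhabited Λ) (M : Turing.TM0.Machine Γ Λ) (S : Finset Λ) (a b : Γ),
    Turing.TM0.Supports M (S : Set Λ) ∧
    ¬ ComputablePred fun n => ∃ t, HaltsWithin M (a :: List.replicate n b) t := by
  obtain ⟨c, hc⟩ := exists_code_halting
  -- A machine starts in the default label, which must therefore be the entry point of `c`.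
  let I : Inhabited Turing.PartrecToTM2.Λ' :=
    ⟨Turing.PartrecToTM2.trNormal c Turing.PartrecToTM2.Cont'.halt⟩
  let M₁ := Turing.TM2to1.tr Turing.PartrecToTM2.tr
  have hfin : Finite (Turing.TM2to1.Γ' Turing.PartrecToTM2.K'
      fun _ => Turing.PartrecToTM2.Γ') :=
    inferInstanceAs (Finite (Bool × (Turing.PartrecToTM2.K' → Option Turing.PartrecToTM2.Γ')))
  refine ⟨_, _, inferInstance, hfin, inferInstance, Turing.TM1to0.tr M₁,
    Turing.TM1to0.trStmts M₁ (Turing.TM2to1.trSupp Turing.PartrecToTM2.tr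
      (Turing.PartrecToTM2.codeSupp c Turing.PartrecToTM2.Cont'.halt)),
    mainSymbol true .cons, mainSymbol false .bit1,
    Turing.TM1to0.tr_supports _ (Turing.TM2to1.tr_supports _
      (Turing.PartrecToTM2.tr_supports c _)), fun h => ?_⟩
  have key : ∀ n, (∃ t, HaltsWithin (Turing.TM1to0.tr M₁)
      (mainSymbol true .cons :: List.replicate n (mainSymbol false .bit1)) t) ↔
      ((Denumerable.ofNat Nat.Partrec.Code n).eval 0).Dom := fun n => by
    have hi : (Turing.TM2.init Turing.PartrecToTM2.K'.main
        (Turing.PartrecToTM2.trList [allOnes n]) : Turing.PartrecToTM2.Cfg') =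
        Turing.PartrecToTM2.init c [allOnes n] := by
      simp only [Turing.TM2.init, Turing.PartrecToTM2.init]
      congr 1
      funext k
      cases k <;> rfl
    have hT : (Turing.TM2.eval Turing.PartrecToTM2.tr Turing.PartrecToTM2.K'.main
        (Turing.PartrecToTM2.trList [allOnes n])).Dom ↔
        (StateTransition.eval (Turing.TM2.step Turing.PartrecToTM2.tr)
          (Turing.PartrecToTM2.init c [allOnes n])).Dom := by
      rw [← hi]; rfl
    rw [← hc, ← eval_dom_iff_haltsWithin, ← trInit_allOnes, Turing.TM1to0.tr_eval]
    refine (Turing.TM2to1.tr_eval_dom _ _ _).trans (hT.trans ?_)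
    rw [Turing.PartrecToTM2.tr_eval]
    rfl
  exact ComputablePred.halting_problem 0 (ComputablePred.computable_of_manyOneReducible
    ⟨Encodable.encode, Computable.encode, fun c => by simp⟩ (h.of_eq key))

theorem terminationUndecidable {f : ℕ → ℕ} (hf : Computable f) (hlim : Tendsto f atTop atTop) :
    TerminationUndecidable f := by
  obtain ⟨Γ, Λ, _, _, _, M, S, a, b, hS, hund⟩ := exists_undecidable_machine
  obtain ⟨code, hcode⟩ := Countable.exists_injective_nat Γ
  obtain ⟨E, -⟩ := Coding.exists_of_supports M S hS code hcode
  refine E.terminationUndecidable hf hlim _ (Primrec.to_comp ?_) hund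
  have : Primrec fun n : ℕ => ((List.range n).map fun _ => E.code b) ++ [E.code a] :=
    Primrec.list_append.comp (Primrec.list_map Primrec.list_range (Primrec.const _).to₂)
      (Primrec.const _)
  refine this.of_eq fun n => ?_
  simp [Coding.reversedInput]

end RDAF

theorem mainTheorem8 :
    (∀ f : ℕ → ℕ, Computable f → Filter.Tendsto f Filter.atTop Filter.atTop →
      RDAF.CanSimulate f ∧ RDAF.TerminationUndecidable f) ∧
    (RDAF.CanSimulate RDAF.inverseAckermann ∧
      RDAF.TerminationUndecidable RDAF.inverseAckermann) :=
  have h : ∀ f : ℕ → ℕ, Computable f → Filter.Tendsto f Filter.atTop Filter.atTop →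
      RDAF.CanSimulate f ∧ RDAF.TerminationUndecidable f :=
    fun _ hf hlim => ⟨RDAF.canSimulate hf hlim, RDAF.terminationUndecidable hf hlim⟩
  ⟨h, h _ RDAF.computable_inverseAckermann RDAF.tendsto_inverseAckermann⟩
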